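/- Consider on the Heisenberg group $G=\mathbb R^3$ with coordinates $q=(x,y,z)$ the left-invariant vector fields $X_1=\partial_x-\frac y2\,\partial_z$, $X_2=\partial_y+\frac x2\,\partial_z$, $X_3=\partial_z$, and the control system $$\dot q=u_1X_1(q)+u_2X_2(q)+u_3X_3(q),\qquad u=(u_1,u_2,u_3)\in U=\{u\in\mathbb R^3\mid -u_1^2+u_2^2+u_3^2\le 0,\ u_1\ge 0\},$$ where the controls $u$ are measurable and essentially bounded and the trajectories are absolutely continuous and satisfy the system almost everywhere. Let $\mathcal A_{q_0}$ be the attainable set of this system from $q_0=(0,0,0)$ for arbitrary nonnegative time, i.e. the set of the points $q(T)$ over all $T\ge 0$ and all such trajectories $q$ on $[0,T]$ with $q(0)=q_0$. Then $$\mathcal A_{q_0}=\Big\{(x,y,z)\ \Big|\ x\ge |y|,\ 0<|z|\le \frac{t+\sinh t}{2},\ t=\operatorname{arcosh}\Big(\frac{x^2-y^2}{2}+1\Big)\Big\}\ \cup\ \{(x,y,z)\mid x\ge |y|,\ z=0\}.$$ -/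

import Mathlib

open MeasureTheory Set

/-- The underlying space `ℝ³` of the Heisenberg group; `q 0, q 1, q 2` are the coordinates
`x, y, z` of the point `q`. -/
abbrev Heis : Type := Fin 3 → ℝ

namespace Heis

/-- `X₁ = ∂/∂x - (y/2) ∂/∂z`. -/
noncomputable def X₁ (q : Heis) : Heis := ![1, 0, -(q 1 / 2)]

/-- `X₂ = ∂/∂y + (x/2) ∂/∂z`. -/
noncomputable def X₂ (q : Heis) : Heis := ![0, 1, q 0 / 2]

/-- `X₃ = ∂/∂z`. -/
def X₃ (_q : Heis) : Heis := ![0, 0, 1]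

/-- The set of control values of the second Lorentzian problem: the cone
`-u₁² + u₂² + u₃² ≤ 0`, `u₁ ≥ 0` (here `u₁, u₂, u₃` are `u 0, u 1, u 2`). -/
def controlCone : Set (Fin 3 → ℝ) :=
  {u | -(u 0) ^ 2 + (u 1) ^ 2 + (u 2) ^ 2 ≤ 0 ∧ 0 ≤ u 0}

/-- `(u, q)` is an admissible process on `[0, T]`: the control `u` is measurable and essentially
bounded with values in the cone, the trajectory `q` is absolutely continuous, and
`q' = u₁ X₁(q) + u₂ X₂(q) + u₃ X₃(q)` almost everywhere on `[0, T]`. -/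
structure IsAdmissible (T : ℝ) (u : ℝ → Fin 3 → ℝ) (q : ℝ → Heis) : Prop where
  memLp : MemLp u ⊤ (volume.restrict (Icc 0 T))
  mem_cone : ∀ᵐ s ∂(volume.restrict (Icc 0 T)), u s ∈ controlCone
  absolutelyContinuous : AbsolutelyContinuousOnInterval q 0 T
  hasDerivAt : ∀ᵐ s ∂(volume.restrict (Icc 0 T)),
    HasDerivAt q (u s 0 • X₁ (q s) + u s 1 • X₂ (q s) + u s 2 • X₃ (q s)) s

/-- The attainable set from `q₀` for arbitrary nonnegative time: the endpoints `q(T)`, `T ≥ 0`,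
of the admissible trajectories with `q(0) = q₀`. -/
def attainableSet (q₀ : Heis) : Set Heis :=
  {q₁ | ∃ T : ℝ, 0 ≤ T ∧ ∃ (u : ℝ → Fin 3 → ℝ) (q : ℝ → Heis),
    IsAdmissible T u q ∧ q 0 = q₀ ∧ q T = q₁}

end Heis

/-! Write `w = x² - y²`. Upper bound: the cone forces `|u₂| ≤ u₁`, hence `|y| ≤ x`. With `P = x u₁ -
y u₂` and `Q = x u₂ - y u₁` one has `w' = 2P`, `z' = u₃ + Q / 2` and `P² - Q² = w (u₁² - u₂²) ≥ w
u₃²`. Cauchy–Schwarz gives `|z'| ≤ √(1 / w + 1 / 4) P`, which is exactly the derivative of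
`maxHeight w` along the trajectory, so `maxHeight w ∓ z` is nondecreasing
(`shift_mul_le_maxHeight`). Attainability: the controls `(cosh, ± sinh, ± 1)` trace a unit hyperbola
in the plane and reach the extreme height; the chord with the same endpoint has height zero. Mixing
the two controls fills in the heights between (`mem_attainableSet_of_hyperbola_chord`). -/

/-- Composition of an absolutely continuous function with a Lipschitz function. -/
theorem LipschitzOnWith.comp_absolutelyContinuousOnInterval {X Y : Type*} [PseudoMetricSpace X]
    [PseudoMetricSpace Y] {K : NNReal} {g : X → Y} {f : ℝ → X} {a b : ℝ} {s : Set X}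
    (hg : LipschitzOnWith K g s) (hf : AbsolutelyContinuousOnInterval f a b)
    (hs : MapsTo f (uIcc a b) s) : AbsolutelyContinuousOnInterval (fun t ↦ g (f t)) a b := by
  rw [absolutelyContinuousOnInterval_iff] at hf ⊢
  intro ε hε
  obtain ⟨δ, hδ, h⟩ := hf (ε / (K + 1)) (by positivity)
  refine ⟨δ, hδ, fun E hE hE' ↦ ?_⟩
  calc ∑ i ∈ Finset.range E.1, dist (g (f (E.2 i).1)) (g (f (E.2 i).2))
      ≤ ∑ i ∈ Finset.range E.1, K * dist (f (E.2 i).1) (f (E.2 i).2) :=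
        Finset.sum_le_sum fun i hi ↦
          hg.dist_le_mul _ (hs (hE.1 i hi).1) _ (hs (hE.1 i hi).2)
    _ = K * ∑ i ∈ Finset.range E.1, dist (f (E.2 i).1) (f (E.2 i).2) :=
        (Finset.mul_sum _ _ _).symm
    _ ≤ K * (ε / (K + 1)) := by gcongr; exact (h E hE hE').le
    _ < (K + 1) * (ε / (K + 1)) := by gcongr; linarith
    _ = ε := by field

theorem AbsolutelyContinuousOnInterval.le_of_ae_hasDerivAt_nonneg {f : ℝ → ℝ} {a b : ℝ}
    (hab : a ≤ b) (hf : AbsolutelyContinuousOnInterval f a b)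
    (h : ∀ᵐ s ∂(volume.restrict (Icc a b)), ∃ d, 0 ≤ d ∧ HasDerivAt f d s) : f a ≤ f b := by
  have h1 : 0 ≤ ∫ s in a..b, deriv f s :=
    intervalIntegral.integral_nonneg_of_ae_restrict hab
      (h.mono fun s ⟨d, hd, hs⟩ ↦ by simpa [hs.deriv] using hd)
  rw [hf.integral_deriv_eq_sub] at h1
  linarith

namespace Heis

/-! ### The extremal height and its derivative -/

/-- The largest value of `z` that can be attained over a point `(x, y)` with `x ^ 2 - y ^ 2 = w`. -/
noncomputable def maxHeight (w : ℝ) : ℝ :=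
  (Real.arcosh (w / 2 + 1) + Real.sinh (Real.arcosh (w / 2 + 1))) / 2

theorem maxHeight_nonneg {w : ℝ} (hw : 0 ≤ w) : 0 ≤ maxHeight w := by
  have h : 0 ≤ Real.arcosh (w / 2 + 1) := Real.arcosh_nonneg (by linarith)
  have := Real.sinh_nonneg_iff.2 h
  unfold maxHeight
  positivity

theorem continuousOn_maxHeight : ContinuousOn maxHeight (Ici 0) := by
  have h : ContinuousOn (fun w : ℝ ↦ Real.arcosh (w / 2 + 1)) (Ici 0) :=
    Real.continuousOn_arcosh.comp (by fun_prop) fun w hw ↦ by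
      simp only [mem_Ici] at hw ⊢; linarith
  exact (h.add (Real.continuous_sinh.comp_continuousOn h)).div_const 2

theorem contDiffOn_maxHeight : ContDiffOn ℝ 1 maxHeight (Ioi 0) := by
  have h : ContDiffOn ℝ 1 (fun w : ℝ ↦ Real.arcosh (w / 2 + 1)) (Ioi 0) :=
    Real.contDiffOn_arcosh.comp (by fun_prop) fun w hw ↦ by
      simp only [mem_Ioi] at hw ⊢; linarith
  exact (h.add (Real.contDiff_sinh.comp_contDiffOn h)).div_const 2

theorem hasDerivAt_maxHeight {w : ℝ} (hw : 0 < w) :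
    HasDerivAt maxHeight (√(1 / w + 1 / 4) / 2) w := by
  have h1 : HasDerivAt (fun w : ℝ ↦ w / 2 + 1) (1 / 2) w :=
    ((hasDerivAt_id w).div_const 2).add_const 1
  have h2 := (Real.hasDerivAt_arcosh (x := w / 2 + 1) (by simp; linarith)).comp w h1
  have h3 := (h2.add h2.sinh).div_const 2
  refine h3.congr_deriv ?_
  simp only [Function.comp]
  rw [Real.cosh_arcosh (by linarith)]
  have e1 : (w / 2 + 1) ^ 2 - 1 = w ^ 2 * (1 / w + 1 / 4) := by field_simp; ring
  have e2 : 0 < 1 / w + 1 / 4 := by positivity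
  rw [e1, Real.sqrt_mul (by positivity), Real.sqrt_sq hw.le]
  have hs := Real.sqrt_pos.2 e2
  have e3 := Real.sq_sqrt e2.le
  generalize √(1 / w + 1 / 4) = r at hs e3 ⊢
  field_simp
  rw [e3]
  field_simp
  ring

/-- Cauchy–Schwarz for `(√w v, Q)` against `(1 / √w, 1 / 2)`. -/
theorem add_half_le_sqrt_mul {w P Q v : ℝ} (hw : 0 < w) (hP : 0 ≤ P)
    (h : w * v ^ 2 + Q ^ 2 ≤ P ^ 2) : |v + Q / 2| ≤ √(1 / w + 1 / 4) * P := by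
  have hP' : P = √(P ^ 2) := (Real.sqrt_sq hP).symm
  rw [hP', ← Real.sqrt_mul (by positivity)]
  apply Real.abs_le_sqrt
  calc (v + Q / 2) ^ 2 ≤ (1 / w + 1 / 4) * (w * v ^ 2 + Q ^ 2) := by
        have : (1 / w + 1 / 4) * (w * v ^ 2 + Q ^ 2) - (v + Q / 2) ^ 2
            = (w * v - 2 * Q) ^ 2 / (4 * w) := by
          field_simp; ring
        have : 0 ≤ (w * v - 2 * Q) ^ 2 / (4 * w) := by positivity
        linarith
    _ ≤ _ := by gcongr

theorem abs_le_of_mem_controlCone {u : Fin 3 → ℝ} (hu : u ∈ controlCone) : |u 1| ≤ u 0 := by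
  obtain ⟨h1, h2⟩ := hu
  exact abs_le_of_sq_le_sq (by nlinarith [sq_nonneg (u 2)]) h2

/-! ### Necessary conditions on endpoints -/

namespace IsAdmissible

variable {T : ℝ} {u : ℝ → Fin 3 → ℝ} {q : ℝ → Heis}

theorem absolutelyContinuous_apply (h : IsAdmissible T u q) (i : Fin 3) :
    AbsolutelyContinuousOnInterval (fun s ↦ q s i) 0 T :=
  ((LipschitzWith.eval (α := fun _ : Fin 3 ↦ ℝ) i).lipschitzOnWith
    (s := univ)).comp_absolutelyContinuousOnInterval h.absolutelyContinuous (mapsTo_univ _ _)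

theorem ae_hasDerivAt_apply (h : IsAdmissible T u q) :
    ∀ᵐ s ∂(volume.restrict (Icc 0 T)), HasDerivAt (fun s ↦ q s 0) (u s 0) s ∧
      HasDerivAt (fun s ↦ q s 1) (u s 1) s ∧
      HasDerivAt (fun s ↦ q s 2) (u s 2 + (q s 0 * u s 1 - q s 1 * u s 0) / 2) s := by
  filter_upwards [h.hasDerivAt] with s hs
  have hs' := hasDerivAt_pi.1 hs
  refine ⟨(hs' 0).congr_deriv ?_, (hs' 1).congr_deriv ?_, (hs' 2).congr_deriv ?_⟩ <;>
    simp [X₁, X₂, X₃]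
  ring

theorem restrict (h : IsAdmissible T u q) {T' : ℝ} (h0 : 0 ≤ T') (hT : T' ≤ T) :
    IsAdmissible T' u q where
  memLp := h.memLp.mono_measure (Measure.restrict_mono (Icc_subset_Icc_right hT) le_rfl)
  mem_cone := ae_restrict_of_ae_restrict_of_subset (Icc_subset_Icc_right hT) h.mem_cone
  absolutelyContinuous := h.absolutelyContinuous.mono <| by
    rw [uIcc_of_le h0, uIcc_of_le (h0.trans hT)]; exact Icc_subset_Icc_right hT
  hasDerivAt := ae_restrict_of_ae_restrict_of_subset (Icc_subset_Icc_right hT) h.hasDerivAt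

theorem abs_le (h : IsAdmissible T u q) (h0 : q 0 = 0) (hT : 0 ≤ T) : |q T 1| ≤ q T 0 := by
  have h1 : q 0 0 - q 0 1 ≤ q T 0 - q T 1 :=
    ((h.absolutelyContinuous_apply 0).fun_sub
      (h.absolutelyContinuous_apply 1)).le_of_ae_hasDerivAt_nonneg hT <| by
      filter_upwards [h.mem_cone, h.ae_hasDerivAt_apply] with s hu hs
      exact ⟨_, by linarith [(_root_.abs_le.1 (abs_le_of_mem_controlCone hu)).2], hs.1.sub hs.2.1⟩
  have h2 : q 0 0 + q 0 1 ≤ q T 0 + q T 1 :=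
    ((h.absolutelyContinuous_apply 0).fun_add
      (h.absolutelyContinuous_apply 1)).le_of_ae_hasDerivAt_nonneg hT <| by
      filter_upwards [h.mem_cone, h.ae_hasDerivAt_apply] with s hu hs
      exact ⟨_, by linarith [(_root_.abs_le.1 (abs_le_of_mem_controlCone hu)).1], hs.1.add hs.2.1⟩
  simp only [h0, Pi.zero_apply] at h1 h2
  exact _root_.abs_le.2 ⟨by linarith, by linarith⟩

theorem sq_le_shift (h : IsAdmissible T u q) (h0 : q 0 = 0) {ε : ℝ} (hε : 0 < ε)
    {s : ℝ} (hs : s ∈ Icc 0 T) : ε ^ 2 ≤ (q s 0 + ε) ^ 2 - (q s 1) ^ 2 := by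
  have h1 := (h.restrict hs.1 hs.2).abs_le h0 hs.1
  nlinarith [abs_nonneg (q s 1), sq_abs (q s 1)]

/-- The derivative of `maxHeight` blows up at `w = 0`, where the trajectory starts. Left translation
by `(ε, 0, 0)` preserves the system, keeps `w ≥ ε²`, and turns `z` into `z + ε y / 2`. The sign `c =
±1` treats both bounds on `z` at once. -/
theorem shift_mul_le_maxHeight (h : IsAdmissible T u q) (h0 : q 0 = 0) (hT : 0 ≤ T) {ε : ℝ}
    (hε : 0 < ε) {c : ℝ} (hc : |c| = 1) :
    c * (q T 2 + ε * q T 1 / 2) ≤ maxHeight ((q T 0 + ε) ^ 2 - (q T 1) ^ 2) := by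
  have hx := h.absolutelyContinuous_apply 0
  have hy := h.absolutelyContinuous_apply 1
  have hz := h.absolutelyContinuous_apply 2
  have hconst : AbsolutelyContinuousOnInterval (fun _ : ℝ ↦ ε) 0 T :=
    (LipschitzWith.const ε).lipschitzOnWith.absolutelyContinuousOnInterval
  have hxε := hx.fun_add hconst
  have hw : AbsolutelyContinuousOnInterval (fun s ↦ (q s 0 + ε) ^ 2 - (q s 1) ^ 2) 0 T := by
    simpa only [sq] using (hxε.fun_mul hxε).fun_sub (hy.fun_mul hy)
  obtain ⟨M, hM⟩ := hw.exists_bound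
  have hmaps : MapsTo (fun s ↦ (q s 0 + ε) ^ 2 - (q s 1) ^ 2) (uIcc 0 T) (Icc (ε ^ 2) M) :=
    fun s hs ↦ ⟨h.sq_le_shift h0 hε (by rwa [uIcc_of_le hT] at hs),
      (le_abs_self _).trans (hM s hs)⟩
  -- Being Lipschitz on a compact interval away from `0`, `maxHeight` preserves absolute continuity.
  obtain ⟨K, hK⟩ := (contDiffOn_maxHeight.mono (s := Ioi 0) (t := Icc (ε ^ 2) M)
    fun w hw ↦ (by positivity : 0 < ε ^ 2).trans_le hw.1).exists_lipschitzOnWith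
      (by decide) (convex_Icc _ _) isCompact_Icc
  have hF := hK.comp_absolutelyContinuousOnInterval hw hmaps
  have hZ := (hz.fun_add (hy.const_mul (ε / 2))).const_mul c
  have key := (hF.fun_sub hZ).le_of_ae_hasDerivAt_nonneg hT <| by
    filter_upwards [h.mem_cone, h.ae_hasDerivAt_apply,
      ae_restrict_mem measurableSet_Icc] with s hu ⟨dx, dy, dz⟩ hs
    have hpos : 0 < (q s 0 + ε) ^ 2 - (q s 1) ^ 2 :=
      (by positivity : 0 < ε ^ 2).trans_le (h.sq_le_shift h0 hε hs)
    have dw := ((dx.add_const ε).pow 2).sub (dy.pow 2)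
    have d := ((hasDerivAt_maxHeight hpos).comp s dw).sub
      ((dz.add (dy.const_mul (ε / 2))).const_mul c)
    refine ⟨_, ?_, d⟩
    have hxy := (h.restrict hs.1 hs.2).abs_le h0 hs.1
    have hu1 := abs_le_of_mem_controlCone hu
    have hP : 0 ≤ (q s 0 + ε) * u s 0 - q s 1 * u s 1 := by
      have : q s 1 * u s 1 ≤ |q s 1| * |u s 1| := by
        rw [← abs_mul]; exact le_abs_self _
      have : |q s 1| * |u s 1| ≤ (q s 0 + ε) * u s 0 :=
        mul_le_mul (by linarith) hu1 (abs_nonneg _) (by linarith [abs_nonneg (q s 1)])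
      linarith
    have hq := add_half_le_sqrt_mul (v := u s 2) (Q := (q s 0 + ε) * u s 1 - q s 1 * u s 0)
      hpos hP (by nlinarith [mul_nonneg hpos.le (sub_nonneg.2 hu.1)])
    have hc' : c * (u s 2 + ((q s 0 + ε) * u s 1 - q s 1 * u s 0) / 2) ≤
        |u s 2 + ((q s 0 + ε) * u s 1 - q s 1 * u s 0) / 2| := by
      refine (le_abs_self _).trans_eq ?_
      rw [abs_mul, hc, one_mul]
    rw [sub_nonneg]
    refine le_trans (le_of_eq ?_) ((hc'.trans hq).trans (le_of_eq ?_))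
    · ring
    · push_cast; ring
  have hnn : 0 ≤ maxHeight (ε ^ 2) := maxHeight_nonneg (sq_nonneg ε)
  simp only [h0, Pi.zero_apply] at key
  simp only [zero_add, mul_zero, ne_eq, OfNat.ofNat_ne_zero, not_false_eq_true, zero_pow,
    sub_zero, add_zero] at key
  have : c * (q T 2 + ε * q T 1 / 2) = c * (q T 2 + ε / 2 * q T 1) := by ring
  linarith

theorem abs_le_maxHeight (h : IsAdmissible T u q) (h0 : q 0 = 0) (hT : 0 ≤ T) :
    |q T 2| ≤ maxHeight ((q T 0) ^ 2 - (q T 1) ^ 2) := by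
  have hxy := h.abs_le h0 hT
  have hw : ∀ ε, 0 ≤ ε → 0 ≤ (q T 0 + ε) ^ 2 - (q T 1) ^ 2 := fun ε hε ↦ by
    nlinarith [abs_nonneg (q T 1), sq_abs (q T 1)]
  have hF : ContinuousOn (fun ε ↦ maxHeight ((q T 0 + ε) ^ 2 - (q T 1) ^ 2)) (Ici 0) :=
    continuousOn_maxHeight.comp (by fun_prop) hw
  have main : ∀ c : ℝ, |c| = 1 → c * q T 2 ≤ maxHeight ((q T 0) ^ 2 - (q T 1) ^ 2) := by
    intro c hc
    have hG : ContinuousOn (fun ε ↦ c * (q T 2 + ε * q T 1 / 2)) (Ici 0) := by fun_prop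
    -- Let `ε → 0⁺`; `maxHeight` is continuous up to `0`.
    have := ContinuousWithinAt.closure_le (s := Ioi (0 : ℝ)) (x := 0) (by simp)
      ((hG 0 self_mem_Ici).mono Ioi_subset_Ici_self) ((hF 0 self_mem_Ici).mono Ioi_subset_Ici_self)
      fun ε hε ↦ h.shift_mul_le_maxHeight h0 hT hε hc
    simpa using this
  have h1 := main 1 (by simp)
  have h2 := main (-1) (by simp)
  exact _root_.abs_le.2 ⟨by linarith, by linarith⟩

end IsAdmissible

/-! ### Construction of trajectories -/

theorem mem_attainableSet_of_hasDerivAt {T : ℝ} (hT : 0 ≤ T) {x y z a b c : ℝ → ℝ}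
    (ha : Continuous a) (hb : Continuous b) (hc : Continuous c)
    (hu : ∀ s, ![a s, b s, c s] ∈ controlCone)
    (hx : ∀ s, HasDerivAt x (a s) s) (hy : ∀ s, HasDerivAt y (b s) s)
    (hz : ∀ s, HasDerivAt z (c s + (x s * b s - y s * a s) / 2) s)
    (h0 : ![x 0, y 0, z 0] = 0) : ![x T, y T, z T] ∈ attainableSet 0 := by
  have hxc : Continuous x := continuous_iff_continuousAt.2 fun s ↦ (hx s).continuousAt
  have hyc : Continuous y := continuous_iff_continuousAt.2 fun s ↦ (hy s).continuousAt
  have hq : ∀ s, HasDerivAt (fun s ↦ ![x s, y s, z s])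
      ![a s, b s, c s + (x s * b s - y s * a s) / 2] s := fun s ↦ by
    refine hasDerivAt_pi.2 fun i ↦ ?_
    fin_cases i
    exacts [hx s, hy s, hz s]
  have huc : Continuous fun s ↦ ![a s, b s, c s] := by
    refine continuous_pi fun i ↦ ?_
    fin_cases i
    exacts [ha, hb, hc]
  refine ⟨T, hT, fun s ↦ ![a s, b s, c s], fun s ↦ ![x s, y s, z s],
    ⟨?_, ae_of_all _ hu, ?_, ae_of_all _ fun s ↦ (hq s).congr_deriv ?_⟩, h0, rfl⟩
  · obtain ⟨C, hC⟩ := isCompact_Icc.exists_bound_of_continuousOn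
      (huc.continuousOn (s := Icc 0 T))
    exact memLp_top_of_bound huc.aestronglyMeasurable C
      ((ae_restrict_mem measurableSet_Icc).mono hC)
  · refine ContDiff.contDiffOn ?_ |>.absolutelyContinuousOnInterval
    refine contDiff_one_iff_deriv.2 ⟨fun s ↦ (hq s).differentiableAt, ?_⟩
    rw [show deriv (fun s ↦ ![x s, y s, z s]) = _ from funext fun s ↦ (hq s).deriv]
    refine continuous_pi fun i ↦ ?_
    fin_cases i
    exacts [ha, hb, hc.add (((hxc.mul hb).sub (hyc.mul ha)).div_const 2)]
  · ext i
    fin_cases i <;> simp [X₁, X₂, X₃]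
    ring

theorem horizontal_mem_attainableSet {x y : ℝ} (h : |y| ≤ x) : ![x, y, 0] ∈ attainableSet 0 := by
  have := mem_attainableSet_of_hasDerivAt (T := 1) zero_le_one (x := fun s ↦ s * x)
    (y := fun s ↦ s * y) (z := fun _ ↦ 0) (a := fun _ ↦ x) (b := fun _ ↦ y) (c := fun _ ↦ 0)
    continuous_const continuous_const continuous_const
    (fun s ↦ ⟨by simpa using sq_le_sq' (by linarith [(abs_le.1 h).1]) (abs_le.1 h).2,
      by simpa using (abs_nonneg y).trans h⟩)
    (fun s ↦ by simpa using (hasDerivAt_id s).mul_const x)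
    (fun s ↦ by simpa using (hasDerivAt_id s).mul_const y)
    (fun s ↦ (hasDerivAt_const s 0).congr_deriv (by ring)) (by simp)
  simpa using this

/-- Every timelike planar vector is a chord of the unit hyperbola. -/
theorem exists_hyperbola_chord {x y : ℝ} (h : |y| < x) : ∃ b : ℝ,
    Real.sinh (b + Real.arcosh ((x ^ 2 - y ^ 2) / 2 + 1)) - Real.sinh b = x ∧
    Real.cosh (b + Real.arcosh ((x ^ 2 - y ^ 2) / 2 + 1)) - Real.cosh b = y := by
  have hx : 0 < x := (abs_nonneg y).trans_lt h
  have hw : 0 < x ^ 2 - y ^ 2 := by nlinarith [abs_nonneg y, sq_abs y]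
  set t := Real.arcosh ((x ^ 2 - y ^ 2) / 2 + 1) with ht
  have hct : Real.cosh t = (x ^ 2 - y ^ 2) / 2 + 1 := Real.cosh_arcosh (by linarith)
  have ht0 : 0 ≤ t := Real.arcosh_nonneg (by linarith)
  have hr := Real.sqrt_pos.2 hw
  have hr2 := Real.sq_sqrt hw.le
  -- The chord over `[p - t / 2, p + t / 2]` is `2 sinh (t / 2) (cosh p, sinh p)`: `t` fixes its
  -- Minkowski length and `p` is the rapidity of `(x, y)`.
  have hs : 2 * Real.sinh (t / 2) = √(x ^ 2 - y ^ 2) := by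
    have h1 : 0 ≤ Real.sinh (t / 2) := Real.sinh_nonneg_iff.2 (by linarith)
    rw [← Real.sqrt_sq (by positivity : 0 ≤ 2 * Real.sinh (t / 2))]
    congr 1
    have h2 := Real.cosh_two_mul (t / 2)
    rw [mul_div_cancel₀ t two_ne_zero] at h2
    linarith [Real.cosh_sq (t / 2)]
  set r := √(x ^ 2 - y ^ 2)
  set p := Real.arsinh (y / r)
  have hsp : Real.sinh p = y / r := Real.sinh_arsinh _
  have hcp : Real.cosh p = x / r := by
    rw [Real.cosh_arsinh, ← Real.sqrt_sq (by positivity : 0 ≤ x / r)]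
    congr 1
    field_simp
    linarith
  refine ⟨p - t / 2, ?_, ?_⟩ <;> rw [show p - t / 2 + t = p + t / 2 by ring]
  · rw [Real.sinh_add, Real.sinh_sub, hcp]
    have : x / r * r = x := by field_simp
    linear_combination (x / r) * hs + this
  · rw [Real.cosh_add, Real.cosh_sub, hsp]
    have : y / r * r = y := by field_simp
    linear_combination (y / r) * hs + this

/-- An instance of convexity of the cone; the cross term is the Minkowski product of two
future-directed planar vectors, hence nonnegative. -/
theorem combination_mem_controlCone {s v₀ v₁ l e : ℝ} (hv : |v₁| ≤ v₀) (hl : l ∈ Icc (0 : ℝ) 1)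
    (he : e ^ 2 = 1) : ![l * Real.cosh s + (1 - l) * v₀, e * (l * Real.sinh s + (1 - l) * v₁),
      e * l] ∈ controlCone := by
  have hl' : 0 ≤ 1 - l := sub_nonneg.2 hl.2
  have hv0 : 0 ≤ v₀ := (abs_nonneg _).trans hv
  have hvv : v₁ ^ 2 ≤ v₀ ^ 2 := sq_le_sq' (by linarith [(abs_le.1 hv).1]) (abs_le.1 hv).2
  have hcs := Real.cosh_sq s
  have hcv : Real.sinh s * v₁ ≤ Real.cosh s * v₀ := by
    refine (le_abs_self _).trans ?_
    rw [abs_mul]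
    refine mul_le_mul ?_ hv (abs_nonneg _) (Real.cosh_pos s).le
    exact abs_le_of_sq_le_sq (by linarith) (Real.cosh_pos s).le
  constructor
  · have h1 : 0 ≤ (1 - l) ^ 2 * (v₀ ^ 2 - v₁ ^ 2) :=
      mul_nonneg (sq_nonneg _) (sub_nonneg.2 hvv)
    have h2 : 0 ≤ 2 * (l * (1 - l)) * (Real.cosh s * v₀ - Real.sinh s * v₁) :=
      mul_nonneg (by linarith [mul_nonneg hl.1 hl']) (sub_nonneg.2 hcv)
    simp only [Matrix.cons_val]
    rw [mul_pow, mul_pow, he]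
    linear_combination h1 + h2 - l ^ 2 * hcs
  · simp only [Matrix.cons_val]
    have := mul_nonneg hl.1 (Real.cosh_pos s).le
    have := mul_nonneg hl' hv0
    linarith

/-- Over the endpoint `(t * v₀, ± t * v₁)` of a chord of the unit hyperbola all the heights up to
the one of the hyperbola are attained, by the convex combinations of the controls that lead along
the hyperbola and along the chord. -/
theorem mem_attainableSet_of_hyperbola_chord {b t v₀ v₁ e c : ℝ} (ht : 0 ≤ t) (hv : |v₁| ≤ v₀)
    (hx : Real.sinh (b + t) - Real.sinh b = t * v₀)
    (hy : Real.cosh (b + t) - Real.cosh b = t * v₁) (he : e ^ 2 = 1)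
    (hc : c ∈ Icc 0 ((t + Real.sinh t) / 2)) :
    ![t * v₀, e * (t * v₁), e * c] ∈ attainableSet 0 := by
  -- Integrated height for `e = 1`: the contribution of `u₃`, the area swept by the hyperbola, and
  -- the mixed area of hyperbola and chord. The mixed term vanishes at `l = 0` and `l = 1`.
  let z : ℝ → ℝ → ℝ := fun l s ↦ l * s + l ^ 2 * ((Real.sinh s - s) / 2) + l * (1 - l) / 2 *
    (2 * ((Real.cosh (b + s) - Real.cosh b - s * Real.sinh b) * v₁
      - (Real.sinh (b + s) - Real.sinh b - s * Real.cosh b) * v₀)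
    + s * (v₀ * (Real.cosh (b + s) - Real.cosh b) - v₁ * (Real.sinh (b + s) - Real.sinh b)))
  have hcont : Continuous fun l ↦ z l t := by fun_prop
  have hz0 : z 0 t = 0 := by simp [z]
  have hz1 : z 1 t = (t + Real.sinh t) / 2 := by simp [z]; ring
  obtain ⟨l, hl, hlc⟩ : c ∈ (fun l ↦ z l t) '' Icc 0 1 :=
    intermediate_value_Icc zero_le_one hcont.continuousOn (by simpa only [hz0, hz1] using hc)
  have hlc' : z l t = c := hlc
  have hbs : ∀ s, HasDerivAt (fun s ↦ b + s) 1 s := fun s ↦ (hasDerivAt_id s).const_add b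
  have hsh : ∀ s, HasDerivAt (fun s ↦ Real.sinh (b + s) - Real.sinh b) (Real.cosh (b + s)) s :=
    fun s ↦ by simpa using (hbs s).sinh.sub_const (Real.sinh b)
  have hch : ∀ s, HasDerivAt (fun s ↦ Real.cosh (b + s) - Real.cosh b) (Real.sinh (b + s)) s :=
    fun s ↦ by simpa using (hbs s).cosh.sub_const (Real.cosh b)
  have hid : ∀ k s : ℝ, HasDerivAt (fun s ↦ s * k) k s :=
    fun k s ↦ by simpa using (hasDerivAt_id s).mul_const k
  have hz : ∀ s, HasDerivAt (z l) (l + ((l * (Real.sinh (b + s) - Real.sinh b) +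
      (1 - l) * (s * v₀)) * (l * Real.sinh (b + s) + (1 - l) * v₁) -
      (l * (Real.cosh (b + s) - Real.cosh b) + (1 - l) * (s * v₁)) *
      (l * Real.cosh (b + s) + (1 - l) * v₀)) / 2) s := fun s ↦ by
    have d := (((hasDerivAt_id s).const_mul l).add
      ((((Real.hasDerivAt_sinh s).sub (hasDerivAt_id s)).div_const 2).const_mul (l ^ 2))).add
      (((((((hch s).sub (hid (Real.sinh b) s)).mul_const v₁).sub
        (((hsh s).sub (hid (Real.cosh b) s)).mul_const v₀)).const_mul 2).add
        ((hasDerivAt_id s).mul (((hch s).const_mul v₀).sub ((hsh s).const_mul v₁)))).const_mul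
        (l * (1 - l) / 2))
    refine d.congr_deriv ?_
    have h1 : Real.cosh s
        = Real.cosh (b + s) * Real.cosh b - Real.sinh (b + s) * Real.sinh b := by
      rw [← Real.cosh_sub]; ring_nf
    have h2 := Real.cosh_sq (b + s)
    simp only [id, Pi.sub_apply]
    linear_combination (l ^ 2 / 2) * h1 + (l ^ 2 / 2) * h2
  have key := mem_attainableSet_of_hasDerivAt ht
    (x := fun s ↦ l * (Real.sinh (b + s) - Real.sinh b) + (1 - l) * (s * v₀))
    (y := fun s ↦ e * (l * (Real.cosh (b + s) - Real.cosh b) + (1 - l) * (s * v₁)))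
    (z := fun s ↦ e * z l s)
    (a := fun s ↦ l * Real.cosh (b + s) + (1 - l) * v₀)
    (b := fun s ↦ e * (l * Real.sinh (b + s) + (1 - l) * v₁)) (c := fun _ ↦ e * l)
    (by fun_prop) (by fun_prop) (by fun_prop)
    (fun s ↦ combination_mem_controlCone hv hl he)
    (fun s ↦ ((hsh s).const_mul l).add ((hid v₀ s).const_mul (1 - l)))
    (fun s ↦ (((hch s).const_mul l).add ((hid v₁ s).const_mul (1 - l))).const_mul e)
    (fun s ↦ ((hz s).const_mul e).congr_deriv (by ring)) (by simp [z])
  convert key using 2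
  · rw [hx]; ring
  · rw [hy, hlc']; congr 1; ring

theorem mem_attainableSet_of_abs_le_maxHeight {q : Heis} (h : |q 1| < q 0)
    (hz : |q 2| ≤ maxHeight ((q 0) ^ 2 - (q 1) ^ 2)) : q ∈ attainableSet 0 := by
  have hq : q = ![q 0, q 1, q 2] := by ext i; fin_cases i <;> rfl
  have hw : 0 < (q 0) ^ 2 - (q 1) ^ 2 := by nlinarith [abs_nonneg (q 1), sq_abs (q 1)]
  have ht : 0 < Real.arcosh (((q 0) ^ 2 - (q 1) ^ 2) / 2 + 1) :=
    Real.arcosh_pos (by linarith)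
  have key : ∀ e : ℝ, e ^ 2 = 1 → ![q 0, q 1, e * |q 2|] ∈ attainableSet 0 := by
    intro e he
    have hey : |e * q 1| = |q 1| := by
      rw [← sq_eq_sq₀ (abs_nonneg _) (abs_nonneg _), sq_abs, sq_abs, mul_pow, he, one_mul]
    obtain ⟨b, hb0, hb1⟩ := exists_hyperbola_chord (h.trans_le' hey.le)
    rw [mul_pow, he, one_mul] at hb0 hb1
    unfold maxHeight at hz
    set t := Real.arcosh (((q 0) ^ 2 - (q 1) ^ 2) / 2 + 1)
    have := mem_attainableSet_of_hyperbola_chord (v₀ := q 0 / t) (v₁ := e * q 1 / t) ht.le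
      (by rw [abs_div, abs_of_pos ht, hey]; gcongr)
      (by rw [hb0]; field_simp) (by rw [hb1]; field_simp) he ⟨abs_nonneg _, hz⟩
    rwa [mul_div_cancel₀ _ ht.ne', mul_div_cancel₀ _ ht.ne', ← mul_assoc, ← sq, he,
      one_mul] at this
  rw [hq]
  rcases abs_choice (q 2) with h2 | h2
  · simpa [h2] using key 1 (by norm_num)
  · simpa [h2] using key (-1) (by norm_num)

end Heis

theorem mainTheorem1 :
    Heis.attainableSet 0 =
      {q : Heis | |q 1| ≤ q 0 ∧ 0 < |q 2| ∧
        ∃ t : ℝ, t = Real.arcosh (((q 0) ^ 2 - (q 1) ^ 2) / 2 + 1) ∧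
          |q 2| ≤ (t + Real.sinh t) / 2} ∪
      {q : Heis | |q 1| ≤ q 0 ∧ q 2 = 0} := by
  ext q
  constructor
  · rintro ⟨T, hT, u, p, h, h0, rfl⟩
    have hxy := h.abs_le h0 hT
    rcases eq_or_ne (p T 2) 0 with hz | hz
    · exact Or.inr ⟨hxy, hz⟩
    · exact Or.inl ⟨hxy, abs_pos.2 hz, _, rfl, h.abs_le_maxHeight h0 hT⟩
  · rintro (⟨hxy, hz0, t, rfl, hz⟩ | ⟨hxy, hz⟩)
    · rcases hxy.lt_or_eq with hlt | heq
      · exact Heis.mem_attainableSet_of_abs_le_maxHeight hlt hz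
      -- On the boundary `x = |y|` the bound is `maxHeight 0 = 0`, which excludes `z ≠ 0`.
      · rw [← heq, sq_abs, sub_self] at hz
        exact absurd hz (by simpa using hz0)
    · have hq : q = ![q 0, q 1, 0] := by ext i; fin_cases i <;> simp [hz]
      rw [hq]
      exact Heis.horizontal_mem_attainableSet hxy
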